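/- All rings are associative. A subring of a ring $R$ is an additive subgroup closed under multiplication; it need not have a multiplicative identity, even if $R$ does. A ring $R$ is called coverable if it is the union of a collection (a cover) of proper subrings, and $\sigma(R)$ denotes the smallest possible size of a cover ($\sigma(R)=\infty$ if $R$ has no finite cover). For a prime $p$ let $F_p$ be the field with $p$ elements, $\mathbb{Z}_4=\mathbb{Z}/4\mathbb{Z}$, and let $T_2(F_p)$ be the ring of upper triangular $2\times 2$ matrices over $F_p$. Let $p$ be a prime. Up to isomorphism, the following is a complete list of the coverable unital rings of order $p^3$, with their covering numbers: 1. $T_2(F_p)$, with $\sigma=p+1$; 2. $F_p[x,y]/(x^2,xy,y^2)$, with $\sigma=p+1$; 3. (only for $p=3$) $F_3\times F_3\times F_3$, with $\sigma=6$; 4. (only for $p=2$) $F_2\times F_2\times F_2$, with $\sigma=3$; 5. (only for $p=2$) $F_2\times F_2[t]/(t^2)$, with $\sigma=3$; 6. (only for $p=2$) $F_2\times\mathbb{Z}_4$, with $\sigma=3$. That is, each of these rings has order $p^3$, is coverable and has the stated covering number, and every coverable unital ring of order $p^3$ is isomorphic to one of them. -/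

import Mathlib

/-- A cover of an associative ring `R`: a collection of proper subrings whose union is `R`.
Subrings are not required to contain a multiplicative unit, even if `R` does. -/
def IsRingCover (R : Type*) [NonUnitalRing R] (C : Set (NonUnitalSubring R)) : Prop :=
  (∀ S ∈ C, S ≠ ⊤) ∧ ∀ r : R, ∃ S ∈ C, r ∈ S

/-- `R` is coverable if it is a union of proper subrings. -/
def IsCoverable (R : Type*) [NonUnitalRing R] : Prop :=
  ∃ C : Set (NonUnitalSubring R), IsRingCover R C

/-- The covering number `σ(R)`: the least size of a cover of `R`; it is `⊤` if `R` has no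
cover, or no finite one. -/
noncomputable def coveringNumber (R : Type*) [NonUnitalRing R] : ℕ∞ :=
  ⨅ C ∈ {C : Set (NonUnitalSubring R) | IsRingCover R C}, C.encard

/-- The ring `T₂(K)` of upper triangular `2 × 2` matrices over `K`. -/
def upperTriangularTwo (K : Type*) [CommRing K] : Subring (Matrix (Fin 2) (Fin 2) K) where
  carrier := {A | A 1 0 = 0}
  mul_mem' := by
    intro A B hA hB
    simp only [Set.mem_ofPred_eq] at hA hB ⊢
    simp [Matrix.mul_apply, hA, hB]
  one_mem' := by simp
  add_mem' := by
    intro A B hA hB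
    simp only [Set.mem_ofPred_eq] at hA hB ⊢
    simp [hA, hB]
  zero_mem' := by simp
  neg_mem' := by
    intro A hA
    simp only [Set.mem_ofPred_eq] at hA ⊢
    simp [hA]

/-- The ring `K[x, y] / (x², xy, y²)`. -/
abbrev TwoVarSquareZero (K : Type*) [CommRing K] : Type _ :=
  MvPolynomial (Fin 2) K ⧸
    (Ideal.span {MvPolynomial.X 0 ^ 2, MvPolynomial.X 0 * MvPolynomial.X 1,
      MvPolynomial.X 1 ^ 2} : Ideal (MvPolynomial (Fin 2) K))

/-- The ring `K[t] / (t²)`. -/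
abbrev OneVarSquareZero (K : Type*) [CommRing K] : Type _ :=
  Polynomial K ⧸ (Ideal.span {Polynomial.X ^ 2} : Ideal (Polynomial K))

/-! ### Covers and covering numbers -/

/-! A ring is coverable exactly when no single element generates it as a non-unital ring, so the
classification looks for generators. The characteristic divides `p ^ 3`. If it equals `p ^ 3`, then
`1` generates. If it is `p ^ 2`, a shift `1 + a` generates unless `p = 2` and the ring splits off an
idempotent (`classification_of_charP_sq`). In characteristic `p` the ring is a 3-dimensional
algebra. If `1, a, a²` is a basis, then `a - c` generates unless `c` is a root of the cubic of `a`;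
all of `F_p` being roots forces `p ≤ 3` (`classification_of_cyclic`). Otherwise every element is
quadratic, and suitable shifts of elements are square-zero or multiples of idempotents
(`classification_of_quadratic`). Covering numbers: counting gives `σ ≥ p + 1`; this is attained by
the planes through `1` when these are subrings, and for `p = 2` by two kernels and an equalizer. For
`F₃³` six elements generate pairwise, and six equalizers and kernels cover. -/

theorem IsCoverable.exists_mem {R : Type*} [NonUnitalRing R] (h : IsCoverable R) (r : R) :
    ∃ S : NonUnitalSubring R, S ≠ ⊤ ∧ r ∈ S := by
  obtain ⟨C, hC, hcov⟩ := h
  obtain ⟨S, hS, hr⟩ := hcov r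
  exact ⟨S, hC S hS, hr⟩

theorem IsCoverable.of_ringEquiv {R S : Type*} [NonUnitalRing R] [NonUnitalRing S]
    (f : R ≃+* S) (h : IsCoverable S) : IsCoverable R := by
  refine ⟨{T | T ≠ ⊤}, fun _ hT => hT, fun r => ?_⟩
  obtain ⟨T, hT, hr⟩ := h.exists_mem (f r)
  refine ⟨T.comap f, fun htop => hT ?_, hr⟩
  rw [eq_top_iff]
  intro s _
  have : f.symm s ∈ T.comap f := by rw [htop]; trivial
  simpa [NonUnitalSubring.mem_comap] using this

/-- An infimum over no covers is `⊤`. This lets coverability of the listed rings be read off their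
covering numbers. -/
theorem isCoverable_of_coveringNumber_ne_top {R : Type*} [NonUnitalRing R]
    (h : coveringNumber R ≠ ⊤) : IsCoverable R := by
  by_contra hR
  apply h
  simp only [coveringNumber, iInf_eq_top]
  exact fun C hC => absurd ⟨C, hC⟩ hR

theorem coveringNumber_le {R : Type*} [NonUnitalRing R] {C : Set (NonUnitalSubring R)}
    (hC : IsRingCover R C) : coveringNumber R ≤ C.encard :=
  iInf₂_le C hC

theorem le_coveringNumber {R : Type*} [NonUnitalRing R] {n : ℕ∞}
    (h : ∀ C, IsRingCover R C → n ≤ C.encard) : n ≤ coveringNumber R :=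
  le_iInf₂ h

theorem coveringNumber_le_card {R ι : Type*} [NonUnitalRing R] [Fintype ι]
    (S : ι → NonUnitalSubring R) (hS : ∀ i, S i ≠ ⊤) (hcov : ∀ r, ∃ i, r ∈ S i) :
    coveringNumber R ≤ Fintype.card ι := by
  have hC : IsRingCover R (Set.range S) := by
    refine ⟨by rintro _ ⟨i, rfl⟩; exact hS i, fun r => ?_⟩
    obtain ⟨i, hi⟩ := hcov r
    exact ⟨S i, ⟨i, rfl⟩, hi⟩
  refine (coveringNumber_le hC).trans ?_
  rw [← Set.image_univ]
  refine (Set.encard_image_le _ _).trans ?_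
  simp

/-- If any two of the elements `x i` generate the ring, each subring of a cover contains at most
one of them. -/
theorem card_le_coveringNumber {R ι : Type*} [NonUnitalRing R] [Fintype ι] (x : ι → R)
    (hx : ∀ i j, i ≠ j → ∀ S : NonUnitalSubring R, x i ∈ S → x j ∈ S → S = ⊤) :
    (Fintype.card ι : ℕ∞) ≤ coveringNumber R := by
  refine le_coveringNumber fun C hC => ?_
  choose S hS hxS using fun i => hC.2 (x i)
  have hinj : Function.Injective S := by
    intro i j hij
    by_contra hne
    exact hC.1 _ (hS i) (hx i j hne _ (hxS i) (hij ▸ hxS j))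
  calc (Fintype.card ι : ℕ∞) = (Set.range S).encard := by
        rw [← Set.image_univ, hinj.encard_image]; simp
    _ ≤ C.encard := Set.encard_le_encard (by rintro _ ⟨i, rfl⟩; exact hS i)

theorem card_nonUnitalSubring_le_sq {R : Type*} [NonUnitalRing R] {p : ℕ} (hp : p.Prime)
    (hR : Nat.card R = p ^ 3) (S : NonUnitalSubring R) (hS : S ≠ ⊤) :
    Nat.card S ≤ p ^ 2 := by
  have : Finite R := Nat.finite_of_card_ne_zero (by rw [hR]; exact pow_ne_zero _ hp.ne_zero)
  have hdvd : Nat.card S ∣ p ^ 3 := hR ▸ AddSubgroup.card_addSubgroup_dvd_card S.toAddSubgroup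
  obtain ⟨k, hk, hk'⟩ := (Nat.dvd_prime_pow hp).1 hdvd
  have : k ≠ 3 := by
    rintro rfl
    apply hS
    have h := AddSubgroup.eq_top_of_card_eq S.toAddSubgroup (hk'.trans hR.symm)
    rw [eq_top_iff]
    intro r _
    have : r ∈ S.toAddSubgroup := by rw [h]; trivial
    exact this
  rw [hk']
  exact Nat.pow_le_pow_right hp.pos (by omega)

/-- All subrings share `0`, so `p` proper ones contain at most `p (p² - 1) < p³ - 1` nonzero
elements. -/
theorem prime_add_one_le_coveringNumber {R : Type*} [NonUnitalRing R] {p : ℕ} (hp : p.Prime)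
    (hR : Nat.card R = p ^ 3) : (p : ℕ∞) + 1 ≤ coveringNumber R := by
  classical
  have : Finite R := Nat.finite_of_card_ne_zero (by rw [hR]; exact pow_ne_zero _ hp.ne_zero)
  have := Fintype.ofFinite R
  refine le_coveringNumber fun C hC => ?_
  by_cases hfin : C.Finite
  swap
  · simp [Set.encard_eq_top (Set.not_finite.1 hfin)]
  lift C to Finset (NonUnitalSubring R) using hfin
  rw [Set.encard_coe_eq_coe_finsetCard]
  have hsub : (Finset.univ.erase (0 : R)) ⊆
      C.biUnion fun S => (Finset.univ.filter (· ∈ S)).erase 0 := by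
    intro r hr
    obtain ⟨S, hS, hrS⟩ := hC.2 r
    simp only [Finset.mem_biUnion, Finset.mem_erase, Finset.mem_filter, Finset.mem_univ, true_and]
    exact ⟨S, hS, Finset.ne_of_mem_erase hr, hrS⟩
  have hcard : p ^ 3 - 1 ≤ C.card * (p ^ 2 - 1) := by
    calc p ^ 3 - 1 = (Finset.univ.erase (0 : R)).card := by
          rw [Finset.card_erase_of_mem (Finset.mem_univ _), Finset.card_univ, ← hR,
            Nat.card_eq_fintype_card]
      _ ≤ _ := Finset.card_le_card hsub
      _ ≤ C.card * (p ^ 2 - 1) := by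
          refine Finset.card_biUnion_le_card_mul _ _ _ fun S hS => ?_
          rw [Finset.card_erase_of_mem (by simp)]
          have := card_nonUnitalSubring_le_sq hp hR S (hC.1 S hS)
          have h2 : Nat.card S = (Finset.univ.filter (· ∈ S)).card := by
            rw [Nat.card_eq_fintype_card, Fintype.card_subtype]
          omega
  have hlt : p < C.card := by
    by_contra hle
    have h1 : p ^ 3 - 1 ≤ p * (p ^ 2 - 1) := hcard.trans (Nat.mul_le_mul_right _ (not_lt.1 hle))
    have h2 : p * (p ^ 2 - 1) = p ^ 3 - p := by rw [Nat.mul_sub, mul_one]; ring_nf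
    have h3 := hp.two_le
    have h4 : p ≤ p ^ 3 := Nat.le_self_pow (by norm_num) p
    omega
  exact_mod_cast hlt

/-- The subring of elements `s + t a`, where `a² = c a + d`. -/
def quadraticSubring {F R : Type*} [CommRing F] [Ring R] [Algebra F R] (a : R) (c d : F)
    (h : a * a = c • a + d • 1) : NonUnitalSubring R where
  carrier := {z | ∃ s t : F, z = s • 1 + t • a}
  mul_mem' := by
    rintro _ _ ⟨s, t, rfl⟩ ⟨s', t', rfl⟩
    refine ⟨s * s' + t * t' * d, s * t' + t * s' + t * t' * c, ?_⟩
    simp only [add_mul, mul_add, smul_mul_smul_comm, one_mul, mul_one, h, smul_add, smul_smul]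
    module
  add_mem' := by
    rintro _ _ ⟨s, t, rfl⟩ ⟨s', t', rfl⟩
    exact ⟨s + s', t + t', by module⟩
  zero_mem' := ⟨0, 0, by simp⟩
  neg_mem' := by
    rintro _ ⟨s, t, rfl⟩
    exact ⟨-s, -t, by module⟩

/-- The lines of `R / F·1` are spanned by `x` and by the `y + l x`, so there are `p + 1` planes
through `1`, and together they fill `R`. Quadraticity of the spanning element makes each plane a
subring. -/
theorem coveringNumber_eq_of_quadratic {p : ℕ} (hp : p.Prime) {R : Type*} [Ring R]
    [Algebra (ZMod p) R] (hR : Nat.card R = p ^ 3) (x y : R)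
    (hspan : ∀ r : R, ∃ α β γ : ZMod p, r = α • 1 + β • x + γ • y)
    (hx : ∃ c d : ZMod p, x * x = c • x + d • 1)
    (hy : ∀ l : ZMod p, ∃ c d : ZMod p,
      (y + l • x) * (y + l • x) = c • (y + l • x) + d • 1) :
    coveringNumber R = p + 1 := by
  have := Fact.mk hp
  refine le_antisymm ?_ (prime_add_one_le_coveringNumber hp hR)
  obtain ⟨c₀, d₀, h₀⟩ := hx
  choose c d h using hy
  let S : Option (ZMod p) → NonUnitalSubring R
    | none => quadraticSubring x c₀ d₀ h₀
    | some l => quadraticSubring (y + l • x) (c l) (d l) (h l)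
  have hproper : ∀ (a : R) (c d : ZMod p) (h), quadraticSubring a c d h ≠ ⊤ := by
    intro a c d h htop
    have hsurj : Function.Surjective
        (fun st : ZMod p × ZMod p => (st.1 • 1 + st.2 • a : R)) := by
      intro z
      obtain ⟨s, t, rfl⟩ : z ∈ quadraticSubring a c d h := by rw [htop]; trivial
      exact ⟨(s, t), rfl⟩
    have := Nat.card_le_card_of_surjective _ hsurj
    rw [hR, Nat.card_prod, Nat.card_zmod, ← pow_two] at this
    exact absurd this (not_le.2 (Nat.pow_lt_pow_right hp.one_lt (by norm_num)))
  refine (coveringNumber_le_card S ?_ ?_).trans (by simp)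
  · rintro (_ | l)
    · exact hproper x c₀ d₀ h₀
    · exact hproper _ _ _ (h l)
  · intro r
    obtain ⟨α, β, γ, rfl⟩ := hspan r
    by_cases hγ : γ = 0
    · exact ⟨none, α, β, by simp [hγ]⟩
    · refine ⟨some (β / γ), α, γ, ?_⟩
      rw [smul_add, smul_smul, mul_div_cancel₀ _ hγ]
      abel

/-- Two elements of `F₂` include a zero or are equal, so the two kernels and the equalizer cover. -/
theorem coveringNumber_eq_three_of_ringHom {R : Type*} [Ring R] (hR : Nat.card R = 2 ^ 3)
    (f g : R →+* ZMod 2) (hfg : f ≠ g) : coveringNumber R = 3 := by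
  refine le_antisymm ?_ ((by norm_num : (3 : ℕ∞) = (2 : ℕ) + 1) ▸
    prime_add_one_le_coveringNumber Nat.prime_two hR)
  let f' : R →ₙ+* ZMod 2 := f
  let g' : R →ₙ+* ZMod 2 := g
  have hproper : ∀ u v : R →ₙ+* ZMod 2, u ≠ v → u.eqLocus v ≠ ⊤ := fun u v huv h =>
    huv (NonUnitalRingHom.ext fun r => by
      have : r ∈ u.eqLocus v := by rw [h]; trivial
      exact this)
  refine (coveringNumber_le_card ![f'.eqLocus 0, g'.eqLocus 0, f'.eqLocus g'] ?_ ?_).trans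
    (by simp)
  · intro i
    fin_cases i
    · exact hproper _ _ fun h => one_ne_zero ((map_one f).symm.trans (DFunLike.congr_fun h 1))
    · exact hproper _ _ fun h => one_ne_zero ((map_one g).symm.trans (DFunLike.congr_fun h 1))
    · exact hproper _ _ fun h => hfg (RingHom.ext fun r => DFunLike.congr_fun h r)
  · intro r
    have key : ∀ a b : ZMod 2, a = 0 ∨ b = 0 ∨ a = b := by decide
    rcases key (f r) (g r) with h | h | h
    · exact ⟨0, h⟩
    · exact ⟨1, h⟩
    · exact ⟨2, h⟩

/-! ### Covering numbers of the product rings -/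

theorem coveringNumber_zmod_two_cube : coveringNumber (ZMod 2 × ZMod 2 × ZMod 2) = 3 := by
  refine coveringNumber_eq_three_of_ringHom (by simp) (RingHom.fst _ _)
    ((RingHom.fst _ _).comp (RingHom.snd _ _)) fun h => ?_
  simpa using DFunLike.congr_fun h (1, 0, 0)

theorem coveringNumber_zmod_two_prod_zmod_four : coveringNumber (ZMod 2 × ZMod 4) = 3 := by
  refine coveringNumber_eq_three_of_ringHom (by simp) (RingHom.fst _ _)
    ((ZMod.castHom (by norm_num) (ZMod 2)).comp (RingHom.snd _ _)) fun h => ?_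
  simpa using DFunLike.congr_fun h (1, 0)

theorem coveringNumber_zmod_two_prod_oneVarSquareZero
    (hcard : Nat.card (ZMod 2 × OneVarSquareZero (ZMod 2)) = 2 ^ 3) :
    coveringNumber (ZMod 2 × OneVarSquareZero (ZMod 2)) = 3 := by
  let ε : OneVarSquareZero (ZMod 2) →+* ZMod 2 :=
    Ideal.Quotient.lift _ (Polynomial.evalRingHom 0) fun a ha => by
      obtain ⟨b, rfl⟩ := Ideal.mem_span_singleton.1 ha
      simp
  refine coveringNumber_eq_three_of_ringHom hcard (RingHom.fst _ _)
    (ε.comp (RingHom.snd _ _)) fun h => ?_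
  simpa using DFunLike.congr_fun h (1, 0)

/-- Six elements of `F₃³`, one for each maximal subring. -/
def zmodThreeCubeElement : Fin 6 → ZMod 3 × ZMod 3 × ZMod 3 :=
  ![(0, 1, 2), (1, 0, 2), (1, 2, 0), (1, 1, 2), (1, 2, 1), (2, 1, 1)]

theorem exists_combination_zmodThreeCubeElement : ∀ i j : Fin 6, i ≠ j → ∀ k : Fin 3,
    ∃ a b c : ZMod 3, (![(1, 0, 0), (0, 1, 0), (0, 0, 1)] k : ZMod 3 × ZMod 3 × ZMod 3) =
      a • zmodThreeCubeElement i + b • (zmodThreeCubeElement i * zmodThreeCubeElement i) +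
        c • zmodThreeCubeElement j := by
  decide

theorem coveringNumber_zmod_three_cube : coveringNumber (ZMod 3 × ZMod 3 × ZMod 3) = 6 := by
  apply le_antisymm
  · let u : ZMod 3 × ZMod 3 × ZMod 3 →ₙ+* ZMod 3 := (RingHom.fst (ZMod 3) (ZMod 3 × ZMod 3))
    let v : ZMod 3 × ZMod 3 × ZMod 3 →ₙ+* ZMod 3 :=
      ((RingHom.fst (ZMod 3) (ZMod 3)).comp (RingHom.snd (ZMod 3) (ZMod 3 × ZMod 3)))
    let w : ZMod 3 × ZMod 3 × ZMod 3 →ₙ+* ZMod 3 :=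
      ((RingHom.snd (ZMod 3) (ZMod 3)).comp (RingHom.snd (ZMod 3) (ZMod 3 × ZMod 3)))
    have hproper : ∀ (f g : ZMod 3 × ZMod 3 × ZMod 3 →ₙ+* ZMod 3) (r), f r ≠ g r →
        f.eqLocus g ≠ ⊤ := fun f g r hr h => hr (by
      have : r ∈ f.eqLocus g := by rw [h]; trivial
      exact this)
    refine (coveringNumber_le_card ![u.eqLocus 0, v.eqLocus 0, w.eqLocus 0, u.eqLocus v,
      u.eqLocus w, v.eqLocus w] ?_ ?_).trans (by simp)
    · intro i
      fin_cases i
      · exact hproper _ _ (1, 0, 0) one_ne_zero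
      · exact hproper _ _ (0, 1, 0) one_ne_zero
      · exact hproper _ _ (0, 0, 1) one_ne_zero
      · exact hproper _ _ (1, 0, 0) one_ne_zero
      · exact hproper _ _ (1, 0, 0) one_ne_zero
      · exact hproper _ _ (0, 1, 0) one_ne_zero
    · rintro ⟨a, b, c⟩
      -- Pigeonhole: `F₃` has only two nonzero values for three coordinates.
      have key : ∀ a b c : ZMod 3, a = 0 ∨ b = 0 ∨ c = 0 ∨ a = b ∨ a = c ∨ b = c := by decide
      rcases key a b c with h | h | h | h | h | h
      · exact ⟨0, h⟩
      · exact ⟨1, h⟩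
      · exact ⟨2, h⟩
      · exact ⟨3, h⟩
      · exact ⟨4, h⟩
      · exact ⟨5, h⟩
  · refine le_trans (by simp) (card_le_coveringNumber zmodThreeCubeElement ?_)
    intro i j hij S hi hj
    have hk : ∀ k, (![(1, 0, 0), (0, 1, 0), (0, 0, 1)] k : ZMod 3 × ZMod 3 × ZMod 3) ∈ S := by
      intro k
      obtain ⟨a, b, c, h⟩ := exists_combination_zmodThreeCubeElement i j hij k
      rw [h]
      exact add_mem (add_mem (ZMod.smul_mem hi a) (ZMod.smul_mem (mul_mem hi hi) b))
        (ZMod.smul_mem hj c)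
    rw [eq_top_iff]
    rintro ⟨a, b, c⟩ _
    have h : ((a, b, c) : ZMod 3 × ZMod 3 × ZMod 3) =
        a • (1, 0, 0) + b • (0, 1, 0) + c • (0, 0, 1) := by simp
    rw [h]
    exact add_mem (add_mem (ZMod.smul_mem (hk 0) a) (ZMod.smul_mem (hk 1) b))
      (ZMod.smul_mem (hk 2) c)

/-! ### Three-dimensional algebras with the same multiplication table -/

theorem linearIndependent_triple {F V : Type*} [Ring F] [AddCommGroup V] [Module F V]
    {x y z : V} (h : ∀ a b c : F, a • x + b • y + c • z = 0 → a = 0 ∧ b = 0 ∧ c = 0) :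
    LinearIndependent F ![x, y, z] := by
  rw [Fintype.linearIndependent_iff]
  intro g hg i
  have := h (g 0) (g 1) (g 2) (by simpa [Fin.sum_univ_three] using hg)
  fin_cases i
  · exact this.1
  · exact this.2.1
  · exact this.2.2

theorem LinearIndependent.eq_zero_of_triple {F V : Type*} [Ring F] [AddCommGroup V] [Module F V]
    {x y z : V} (h : LinearIndependent F ![x, y, z]) {a b c : F}
    (h0 : a • x + b • y + c • z = 0) : a = 0 ∧ b = 0 ∧ c = 0 := by
  rw [Fintype.linearIndependent_iff] at h
  have := h ![a, b, c] (by simpa [Fin.sum_univ_three] using h0)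
  exact ⟨this 0, this 1, this 2⟩

section Field

variable {F : Type*} [Field F]

open Module

theorem LinearIndependent.exists_eq_of_triple {V : Type*} [AddCommGroup V] [Module F V]
    (hV : finrank F V = 3) {x y z : V} (h : LinearIndependent F ![x, y, z]) (v : V) :
    ∃ a b c : F, v = a • x + b • y + c • z := by
  let b := basisOfLinearIndependentOfCardEqFinrank h (by simp [hV])
  refine ⟨b.repr v 0, b.repr v 1, b.repr v 2, ?_⟩
  conv_lhs => rw [← b.sum_repr v]
  simp [Fin.sum_univ_three, b]

theorem finrank_eq_three_of_triple {V : Type*} [AddCommGroup V] [Module F V] {x y z : V}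
    (h : LinearIndependent F ![x, y, z])
    (hspan : ∀ v : V, ∃ a b c : F, v = a • x + b • y + c • z) : finrank F V = 3 := by
  have htop : ⊤ ≤ Submodule.span F (Set.range ![x, y, z]) := by
    intro v _
    obtain ⟨a, b, c, rfl⟩ := hspan v
    have hm : ∀ i, ![x, y, z] i ∈ Submodule.span F (Set.range ![x, y, z]) := fun i =>
      Submodule.subset_span ⟨i, rfl⟩
    exact add_mem (add_mem (Submodule.smul_mem _ _ (hm 0)) (Submodule.smul_mem _ _ (hm 1)))
      (Submodule.smul_mem _ _ (hm 2))
  simpa using finrank_eq_card_basis (Basis.mk h htop)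

/-- Multiplicativity is bilinear, hence checked on the basis. Quantifying over every `L` with the
prescribed values lets callers expand the nine products by simplification without naming the
isomorphism. -/
theorem nonempty_ringEquiv_of_triple {R S : Type*} [Ring R] [Ring S] [Algebra F R] [Algebra F S]
    (hR : finrank F R = 3) (hS : finrank F S = 3) {x y z : R} {x' y' z' : S}
    (h : LinearIndependent F ![x, y, z]) (h' : LinearIndependent F ![x', y', z'])
    (hmul : ∀ L : R →ₗ[F] S, L x = x' → L y = y' → L z = z' → ∀ i j,
      L (![x, y, z] i * ![x, y, z] j) = ![x', y', z'] i * ![x', y', z'] j) :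
    Nonempty (R ≃+* S) := by
  let b := basisOfLinearIndependentOfCardEqFinrank h (by simp [hR])
  let b' := basisOfLinearIndependentOfCardEqFinrank h' (by simp [hS])
  let L : R ≃ₗ[F] S := b.equiv b' (Equiv.refl _)
  have hL : ∀ i, L (![x, y, z] i) = ![x', y', z'] i := fun i => by
    have := b.equiv_apply i b' (Equiv.refl _)
    simpa [b, b'] using this
  have hLmul : ∀ u v : R, L (u * v) = L u * L v := by
    have : (LinearMap.mul F R).compr₂ L.toLinearMap =
        (LinearMap.mul F S).compl₁₂ L.toLinearMap L.toLinearMap := by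
      refine b.ext fun i => b.ext fun j => ?_
      simp only [b, LinearMap.compr₂_apply, LinearMap.mul_apply', LinearMap.compl₁₂_apply,
        coe_basisOfLinearIndependentOfCardEqFinrank, LinearEquiv.coe_coe, hL]
      exact hmul L.toLinearMap (hL 0) (hL 1) (hL 2) i j
    exact fun u v => LinearMap.congr_fun₂ this u v
  exact ⟨{ L.toAddEquiv with map_mul' := hLmul }⟩

/-- The cubic relation determines the whole multiplication table. It has no constant term because in
the coverable case `0` is a root. -/
theorem nonempty_ringEquiv_of_cube {R S : Type*} [Ring R] [Ring S] [Algebra F R] [Algebra F S]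
    (hR : finrank F R = 3) (hS : finrank F S = 3) {a : R} {a' : S}
    (h : LinearIndependent F ![1, a, a * a]) (h' : LinearIndependent F ![1, a', a' * a'])
    {β γ : F} (ha : a * (a * a) = β • a + γ • (a * a))
    (ha' : a' * (a' * a') = β • a' + γ • (a' * a')) : Nonempty (R ≃+* S) := by
  have h4 : a * a * (a * a) = β • (a * a) + γ • (β • a + γ • (a * a)) := by
    rw [mul_assoc, ha, mul_add, mul_smul_comm, mul_smul_comm, ha]
  have h4' : a' * a' * (a' * a') = β • (a' * a') + γ • (β • a' + γ • (a' * a')) := by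
    rw [mul_assoc, ha', mul_add, mul_smul_comm, mul_smul_comm, ha']
  refine nonempty_ringEquiv_of_triple hR hS h h' fun L h₁ h₂ h₃ i j => ?_
  fin_cases i <;> fin_cases j <;> simp [h₁, h₂, h₃, h4, h4', ha, ha', mul_assoc a a a,
    mul_assoc a' a' a']

end Field

theorem finrank_zmod_eq_three {p : ℕ} [Fact p.Prime] {V : Type*} [AddCommGroup V]
    [Module (ZMod p) V] (hV : Nat.card V = p ^ 3) : Module.finrank (ZMod p) V = 3 := by
  have hp : p.Prime := Fact.out
  have : Finite V := Nat.finite_of_card_ne_zero (by rw [hV]; exact pow_ne_zero _ hp.ne_zero)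
  have h := Module.natCard_eq_pow_finrank (K := ZMod p) (V := V)
  rw [hV, Nat.card_zmod] at h
  exact (Nat.pow_right_injective hp.two_le h).symm

theorem natCard_eq_of_finrank_zmod {p : ℕ} [Fact p.Prime] {V : Type*} [AddCommGroup V]
    [Module (ZMod p) V] (hV : Module.finrank (ZMod p) V = 3) : Nat.card V = p ^ 3 := by
  have : Module.Finite (ZMod p) V := Module.finite_of_finrank_pos (by omega)
  rw [Module.natCard_eq_pow_finrank (K := ZMod p) (V := V), hV, Nat.card_zmod]

/-! ### Upper triangular matrices -/

namespace upperTriangularTwo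

variable (K : Type*) [CommRing K]

noncomputable instance : Algebra K (upperTriangularTwo K) :=
  ((algebraMap K (Matrix (Fin 2) (Fin 2) K)).codRestrict (upperTriangularTwo K) fun r => by
    change algebraMap K (Matrix (Fin 2) (Fin 2) K) r 1 0 = 0
    simp [Matrix.algebraMap_matrix_apply]).toAlgebra' fun r A =>
      Subtype.ext (Algebra.commutes r A.1)

noncomputable instance (p : ℕ) : SMul (ZMod p) (upperTriangularTwo (ZMod p)) := Algebra.toSMul

noncomputable instance (p : ℕ) : Module (ZMod p) (upperTriangularTwo (ZMod p)) :=
  Algebra.toModule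

theorem coe_smul (c : K) (A : upperTriangularTwo K) :
    ((c • A : upperTriangularTwo K) : Matrix (Fin 2) (Fin 2) K) = c • A.1 :=
  (Algebra.smul_def c A.1).symm

/-- The upper triangular matrix with entries `a`, `b`, `c`. -/
def of (a b c : K) : upperTriangularTwo K := ⟨!![a, b; 0, c], rfl⟩

variable {K}

theorem eq_of (A : upperTriangularTwo K) : A = of K (A.1 0 0) (A.1 0 1) (A.1 1 1) := by
  obtain ⟨A, hA⟩ := A
  have hA : A 1 0 = 0 := hA
  ext i j
  fin_cases i <;> fin_cases j <;> simp [of, hA]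

theorem of_mul_of (a b c a' b' c' : K) :
    of K a b c * of K a' b' c' = of K (a * a') (a * b' + b * c') (c * c') := by
  ext i j
  fin_cases i <;> fin_cases j <;> simp [of]

theorem of_add_of (a b c a' b' c' : K) :
    of K a b c + of K a' b' c' = of K (a + a') (b + b') (c + c') := by
  ext i j
  fin_cases i <;> fin_cases j <;> simp [of]

theorem smul_of (r a b c : K) : r • of K a b c = of K (r * a) (r * b) (r * c) := by
  ext i j
  rw [coe_smul]
  fin_cases i <;> fin_cases j <;> simp [of]

theorem one_eq_of : (1 : upperTriangularTwo K) = of K 1 0 1 := by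
  ext i j
  fin_cases i <;> fin_cases j <;> simp [of]

theorem zero_eq_of : (0 : upperTriangularTwo K) = of K 0 0 0 := by
  ext i j
  fin_cases i <;> fin_cases j <;> simp [of]

theorem of_inj {a b c a' b' c' : K} : of K a b c = of K a' b' c' ↔ a = a' ∧ b = b' ∧ c = c' := by
  refine ⟨fun h => ?_, by rintro ⟨rfl, rfl, rfl⟩; rfl⟩
  have h := congrArg Subtype.val h
  exact ⟨congrFun (congrFun h 0) 0, congrFun (congrFun h 0) 1, congrFun (congrFun h 1) 1⟩

theorem linearIndependent :
    LinearIndependent K ![of K 1 0 0, of K 0 1 0, of K 0 0 1] := by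
  refine linearIndependent_triple fun a b c h => ?_
  simpa [smul_of, of_add_of, zero_eq_of, of_inj] using h

theorem finrank_eq_three {F : Type*} [Field F] :
    Module.finrank F (upperTriangularTwo F) = 3 := by
  refine finrank_eq_three_of_triple linearIndependent fun A => ⟨A.1 0 0, A.1 0 1, A.1 1 1, ?_⟩
  conv_lhs => rw [eq_of A]
  simp [smul_of, of_add_of]

theorem natCard_eq {p : ℕ} (hp : p.Prime) : Nat.card (upperTriangularTwo (ZMod p)) = p ^ 3 :=
  have := Fact.mk hp
  natCard_eq_of_finrank_zmod finrank_eq_three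

theorem coveringNumber_eq {p : ℕ} (hp : p.Prime) :
    coveringNumber (upperTriangularTwo (ZMod p)) = p + 1 := by
  have := Fact.mk hp
  -- `E₁₂` squares to zero and every `E₁₁ + l E₁₂` is idempotent.
  refine coveringNumber_eq_of_quadratic hp (natCard_eq hp) (of _ 0 1 0) (of _ 1 0 0)
    (fun A => ⟨A.1 1 1, A.1 0 1, A.1 0 0 - A.1 1 1, ?_⟩) ⟨0, 0, ?_⟩ fun l => ⟨1, 0, ?_⟩
  · conv_lhs => rw [eq_of A]
    simp [one_eq_of, smul_of, of_add_of]
  · rw [zero_smul, zero_smul, add_zero, of_mul_of, zero_eq_of]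
    simp
  · simp [smul_of, of_add_of, of_mul_of]

end upperTriangularTwo

/-! ### The ring `K[x, y] / (x², xy, y²)` -/

namespace TwoVarSquareZero

open MvPolynomial

variable (K : Type*) [CommRing K]

noncomputable instance : SMul K (TwoVarSquareZero K) := Algebra.toSMul

noncomputable instance : Module K (TwoVarSquareZero K) := Algebra.toModule

/-- The class of `x`. -/
noncomputable def x : TwoVarSquareZero K := Ideal.Quotient.mk _ (X 0)

/-- The class of `y`. -/
noncomputable def y : TwoVarSquareZero K := Ideal.Quotient.mk _ (X 1)

theorem x_mul_x : x K * x K = 0 := by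
  rw [x, ← map_mul, Ideal.Quotient.eq_zero_iff_mem, ← pow_two]
  exact Ideal.subset_span (by simp)

theorem x_mul_y : x K * y K = 0 := by
  rw [x, y, ← map_mul, Ideal.Quotient.eq_zero_iff_mem]
  exact Ideal.subset_span (by simp)

theorem y_mul_y : y K * y K = 0 := by
  rw [y, ← map_mul, Ideal.Quotient.eq_zero_iff_mem, ← pow_two]
  exact Ideal.subset_span (by simp)

theorem y_mul_x : y K * x K = 0 := by rw [mul_comm, x_mul_y]

variable {K}

theorem exists_eq (q : TwoVarSquareZero K) :
    ∃ a b c : K, q = a • 1 + b • x K + c • y K := by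
  obtain ⟨f, rfl⟩ := Ideal.Quotient.mk_surjective q
  induction f using MvPolynomial.induction_on with
  | C a => exact ⟨a, 0, 0, by
    rw [zero_smul, zero_smul, add_zero, add_zero, Algebra.smul_def, mul_one]; rfl⟩
  | add f g hf hg =>
    obtain ⟨a, b, c, hf⟩ := hf
    obtain ⟨a', b', c', hg⟩ := hg
    exact ⟨a + a', b + b', c + c', by rw [map_add, hf, hg]; module⟩
  | mul_X f i hf =>
    obtain ⟨a, b, c, hf⟩ := hf
    rw [map_mul, hf]
    fin_cases i
    · refine ⟨0, a, 0, ?_⟩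
      change _ * x K = _
      simp [add_mul, x_mul_x, y_mul_x]
    · refine ⟨0, 0, a, ?_⟩
      change _ * y K = _
      simp [add_mul, x_mul_y, y_mul_y]

/-- The quotient maps to the square-zero extension of `K` by `K²`, where the images are visibly
independent; this shows that the quotient does not collapse. -/
theorem linearIndependent : LinearIndependent K ![1, x K, y K] := by
  refine linearIndependent_triple fun a b c h => ?_
  let g : MvPolynomial (Fin 2) K →ₐ[K] TrivSqZeroExt K (K × K) :=
    aeval ![TrivSqZeroExt.inr (1, 0), TrivSqZeroExt.inr (0, 1)]
  let ψ : TwoVarSquareZero K →ₐ[K] TrivSqZeroExt K (K × K) :=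
    Ideal.Quotient.liftₐ _ g fun f hf => by
      refine Submodule.span_induction (fun q hq => ?_) (map_zero g)
        (fun q r _ _ hq hr => by rw [map_add, hq, hr, add_zero])
        (fun q r _ hr => by rw [smul_eq_mul, map_mul, hr, mul_zero]) hf
      rcases hq with rfl | rfl | rfl <;> simp [g, pow_two]
  have hx : ψ (x K) = TrivSqZeroExt.inr (1, 0) := by
    exact (aeval_X _ _).trans (by simp)
  have hy : ψ (y K) = TrivSqZeroExt.inr (0, 1) := by
    exact (aeval_X _ _).trans (by simp)
  have h := congrArg ψ h
  rw [map_add, map_add, map_smul, map_smul, map_smul, hx, hy, map_one, map_zero] at h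
  have h1 := congrArg TrivSqZeroExt.fst h
  have h2 := congrArg TrivSqZeroExt.snd h
  simp at h1 h2
  exact ⟨h1, h2.1, h2.2⟩

theorem finrank_eq_three {F : Type*} [Field F] :
    Module.finrank F (TwoVarSquareZero F) = 3 :=
  finrank_eq_three_of_triple linearIndependent exists_eq

theorem natCard_eq {p : ℕ} (hp : p.Prime) : Nat.card (TwoVarSquareZero (ZMod p)) = p ^ 3 :=
  have := Fact.mk hp
  natCard_eq_of_finrank_zmod finrank_eq_three

theorem coveringNumber_eq {p : ℕ} (hp : p.Prime) :
    coveringNumber (TwoVarSquareZero (ZMod p)) = p + 1 := by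
  have := Fact.mk hp
  refine coveringNumber_eq_of_quadratic hp (natCard_eq hp) (x _) (y _)
    exists_eq ⟨0, 0, ?_⟩ fun l => ⟨0, 0, ?_⟩
  · simp [x_mul_x]
  · simp [add_mul, mul_add, x_mul_x, y_mul_y, x_mul_y, y_mul_x]

end TwoVarSquareZero

/-! ### The ring `K[t] / (t²)` -/

namespace OneVarSquareZero

open Polynomial

variable (K : Type*) [CommRing K]

noncomputable instance : SMul K (OneVarSquareZero K) := Algebra.toSMul

noncomputable instance : Module K (OneVarSquareZero K) := Algebra.toModule

/-- The class of `t`. -/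
noncomputable def t : OneVarSquareZero K := Ideal.Quotient.mk _ X

theorem t_mul_t : t K * t K = 0 := by
  rw [t, ← map_mul, Ideal.Quotient.eq_zero_iff_mem, ← pow_two]
  exact Ideal.subset_span rfl

variable {K}

theorem exists_eq (q : OneVarSquareZero K) : ∃ a b : K, q = a • 1 + b • t K := by
  obtain ⟨f, rfl⟩ := Ideal.Quotient.mk_surjective q
  induction f using Polynomial.induction_on with
  | C a => exact ⟨a, 0, by
    rw [zero_smul, add_zero, Algebra.smul_def, mul_one]; rfl⟩
  | add f g hf hg =>
    obtain ⟨a, b, hf⟩ := hf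
    obtain ⟨a', b', hg⟩ := hg
    exact ⟨a + a', b + b', by rw [map_add, hf, hg]; module⟩
  | monomial n c hf =>
    obtain ⟨a, b, hf⟩ := hf
    refine ⟨0, a, ?_⟩
    rw [pow_succ X n, ← mul_assoc, map_mul, hf]
    change _ * t K = _
    simp [add_mul, t_mul_t]

theorem eq_zero_of_add_eq_zero {a b : K} (h : a • 1 + b • t K = 0) : a = 0 ∧ b = 0 := by
  let ψ : OneVarSquareZero K →ₐ[K] DualNumber K :=
    Ideal.Quotient.liftₐ _ (aeval DualNumber.eps) fun f hf => by
      obtain ⟨g, rfl⟩ := Ideal.mem_span_singleton.1 hf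
      simp [pow_two]
  have ht : ψ (t K) = DualNumber.eps := by
    exact aeval_X _
  have h := congrArg ψ h
  rw [map_add, map_smul, map_smul, ht, map_one, map_zero] at h
  have h1 := congrArg TrivSqZeroExt.fst h
  have h2 := congrArg TrivSqZeroExt.snd h
  simp at h1 h2
  exact ⟨h1, h2⟩

theorem linearIndependent_prod :
    LinearIndependent K ![((1, 0) : K × OneVarSquareZero K), (0, 1), (0, t K)] := by
  refine linearIndependent_triple fun a b c h => ?_
  have h1 := congrArg Prod.fst h
  have h2 := congrArg Prod.snd h
  simp only [Prod.fst_add, Prod.snd_add, Prod.smul_fst, Prod.smul_snd, smul_zero, add_zero,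
    zero_add, Prod.fst_zero, Prod.snd_zero, smul_eq_mul, mul_one, mul_zero] at h1 h2
  exact ⟨h1, eq_zero_of_add_eq_zero h2⟩

theorem finrank_prod_eq_three {F : Type*} [Field F] :
    Module.finrank F (F × OneVarSquareZero F) = 3 := by
  refine finrank_eq_three_of_triple linearIndependent_prod ?_
  rintro ⟨a, q⟩
  obtain ⟨b, c, rfl⟩ := exists_eq q
  exact ⟨a, b, c, by simp⟩

theorem natCard_prod_eq {p : ℕ} (hp : p.Prime) :
    Nat.card (ZMod p × OneVarSquareZero (ZMod p)) = p ^ 3 :=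
  have := Fact.mk hp
  natCard_eq_of_finrank_zmod finrank_prod_eq_three

end OneVarSquareZero

/-! ### Three-dimensional algebras all of whose elements are quadratic -/

section Quadratic

open Module

variable {F R : Type*} [Field F] [Ring R] [Algebra F R]

theorem linearIndependent_one_of_notMem [Nontrivial R] {a v : R} (ha : ∀ c : F, a ≠ c • 1)
    (hv : ∀ c d : F, v ≠ c • 1 + d • a) : LinearIndependent F ![1, a, v] := by
  refine linearIndependent_triple fun x y z h => ?_
  have hz : z = 0 := by
    by_contra hz
    refine hv (-(z⁻¹ * x)) (-(z⁻¹ * y)) ?_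
    have h1 : z • v = -(x • 1 + y • a) := eq_neg_of_add_eq_zero_right h
    rw [← inv_smul_smul₀ hz v, h1]
    module
  subst hz
  have hy : y = 0 := by
    by_contra hy
    refine ha (-(y⁻¹ * x)) ?_
    have h1 : y • a = -(x • 1) := eq_neg_of_add_eq_zero_right (by simpa using h)
    rw [← inv_smul_smul₀ hy a, h1]
    module
  subst hy
  simpa using h

theorem exists_ne_smul_one (hR : finrank F R = 3) : ∃ a : R, ∀ c : F, a ≠ c • 1 := by
  by_contra! h
  have := finrank_le_one (R := F) (1 : R) fun w => ⟨(h w).choose, (h w).choose_spec.symm⟩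
  omega

theorem exists_ne_combination (hR : finrank F R = 3) (a : R) :
    ∃ v : R, ∀ c d : F, v ≠ c • 1 + d • a := by
  by_contra! h
  have hs : Submodule.span F (Set.range ![1, a]) = ⊤ := by
    rw [eq_top_iff]
    intro v _
    obtain ⟨c, d, rfl⟩ := h v
    exact add_mem (Submodule.smul_mem _ _ (Submodule.subset_span ⟨0, rfl⟩))
      (Submodule.smul_mem _ _ (Submodule.subset_span ⟨1, rfl⟩))
  have := finrank_range_le_card (R := F) ![1, a]
  rw [Set.finrank, hs, finrank_top, hR] at this
  simp at this

theorem linearIndependent_or_quadratic (a : R) :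
    LinearIndependent F ![1, a, a * a] ∨ ∃ s t : F, a * a = s • a + t • 1 := by
  by_cases hR : Nontrivial R
  swap
  · rw [not_nontrivial_iff_subsingleton] at hR
    exact Or.inr ⟨0, 0, Subsingleton.elim _ _⟩
  by_cases ha : ∃ c : F, a = c • 1
  · obtain ⟨c, rfl⟩ := ha
    exact Or.inr ⟨c, 0, by simp⟩
  by_cases hv : ∃ c d : F, a * a = c • 1 + d • a
  · obtain ⟨c, d, h⟩ := hv
    exact Or.inr ⟨d, c, by rw [h, add_comm]⟩
  push Not at ha hv
  exact Or.inl (linearIndependent_one_of_notMem ha hv)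

/-- In a three-dimensional algebra a quadratic element has an eigenvalue in the base field, as left
multiplication by it acts on the one-dimensional quotient by `⟨1, a⟩`. -/
theorem exists_sub_mul_sub_eq_smul (hR : finrank F R = 3) {a : R} {s t : F}
    (ha : a * a = s • a + t • 1) :
    ∃ l k : F, (a - l • 1) * (a - l • 1) = k • (a - l • 1) := by
  have : Nontrivial R := nontrivial_of_finrank_pos (R := F) (by omega)
  by_cases ha1 : ∃ c : F, a = c • 1
  · obtain ⟨c, rfl⟩ := ha1
    exact ⟨c, 0, by simp⟩
  push Not at ha1
  obtain ⟨v, hv⟩ := exists_ne_combination hR a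
  have hli := linearIndependent_one_of_notMem ha1 hv
  obtain ⟨m, n, l, hav⟩ := hli.exists_eq_of_triple hR (a * v)
  have h1 : a * (a * v) = m • a + n • (s • a + t • 1) + l • (m • 1 + n • a + l • v) := by
    rw [← hav, ← ha]
    conv_lhs => rw [hav]
    simp only [mul_add, mul_smul_comm, mul_one]
  have h2 : a * (a * v) = s • (m • 1 + n • a + l • v) + t • v := by
    rw [← mul_assoc, ha, ← hav, add_mul, smul_mul_assoc, smul_mul_assoc, one_mul]
  have h3 := (hli.eq_zero_of_triple (a := n * t + l * m - s * m)
    -- Comparing the coefficients of `v` in the two expansions of `a (a v)` gives `l² = s l + t`.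
    (b := m + n * s + l * n - s * n) (c := l * l - s * l - t) (by
      rw [h1] at h2
      rw [← sub_eq_zero] at h2
      rw [← h2]
      module)).2.2
  -- The other root of `X² - s X - t` is `s - l`, so `(a - l)(a - (s - l)) = 0`.
  refine ⟨l, s - 2 * l, ?_⟩
  have ht : t = l * l - s * l := by linear_combination -h3
  simp only [sub_mul, mul_sub, smul_mul_assoc, mul_smul_comm, one_mul, mul_one, ha, ht]
  module

/-- Write `xy = α + βx + γy`. Multiplying by `x` on the left gives `γ² = 0`, then `α = 0`;
multiplying by `y` on the right gives `β² = 0`. -/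
theorem mul_eq_zero_of_sq_zero (hR : finrank F R = 3) {x y : R}
    (hli : LinearIndependent F ![1, x, y]) (hx : x * x = 0) (hy : y * y = 0) : x * y = 0 := by
  obtain ⟨α, β, γ, h⟩ := hli.exists_eq_of_triple hR (x * y)
  have h1 : α • x + γ • (α • 1 + β • x + γ • y) = 0 := by
    have : x * (x * y) = 0 := by rw [← mul_assoc, hx, zero_mul]
    rw [← h, ← this]
    conv_rhs => rw [h]
    simp [mul_add, hx]
  have h2 := hli.eq_zero_of_triple (a := γ * α) (b := α + γ * β) (c := γ * γ) (by
    rw [← h1]; module)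
  have hγ : γ = 0 := mul_self_eq_zero.1 h2.2.2
  have hα : α = 0 := by simpa [hγ] using h2.2.1
  simp only [hγ, hα, zero_smul, zero_add, add_zero] at h
  have h3 : β • (β • x) = 0 := by
    have : x * y * y = 0 := by rw [mul_assoc, hy, mul_zero]
    rw [← h, ← this, h, smul_mul_assoc, h]
  have h4 := hli.eq_zero_of_triple (a := 0) (b := β * β) (c := 0) (by
    rw [← h3]; module)
  rw [h, mul_self_eq_zero.1 h4.2.1, zero_smul]

theorem nonempty_ringEquiv_twoVarSquareZero (hR : finrank F R = 3) {x y : R}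
    (hli : LinearIndependent F ![1, x, y]) (hx : x * x = 0) (hy : y * y = 0) :
    Nonempty (R ≃+* TwoVarSquareZero F) := by
  have hli' : LinearIndependent F ![1, y, x] := linearIndependent_triple fun a b c h => by
    have := hli.eq_zero_of_triple (a := a) (b := c) (c := b) (by rw [← h]; abel)
    exact ⟨this.1, this.2.2, this.2.1⟩
  have hxy := mul_eq_zero_of_sq_zero hR hli hx hy
  have hyx := mul_eq_zero_of_sq_zero hR hli' hy hx
  refine nonempty_ringEquiv_of_triple hR TwoVarSquareZero.finrank_eq_three hli
    TwoVarSquareZero.linearIndependent fun L h₁ h₂ h₃ i j => ?_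
  fin_cases i <;> fin_cases j <;> simp [h₁, h₂, h₃, hx, hy, hxy, hyx, TwoVarSquareZero.x_mul_x,
    TwoVarSquareZero.x_mul_y, TwoVarSquareZero.y_mul_x, TwoVarSquareZero.y_mul_y]

/-- A nonzero `n` in the Peirce corner `e R (1 - e)` plays the part of `E₁₂`, with `e` and `1 - e`
as `E₁₁` and `E₂₂`. -/
theorem nonempty_ringEquiv_upperTriangularTwo (hR : finrank F R = 3) {e n : R}
    (he : e * e = e) (hn : n ≠ 0) (hen : e * n = n) (hne : n * e = 0) :
    Nonempty (R ≃+* upperTriangularTwo F) := by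
  have hnn : n * n = 0 := by
    calc n * n = n * (e * n) := by rw [hen]
      _ = 0 := by rw [← mul_assoc, hne, zero_mul]
  have hli : LinearIndependent F ![e, n, 1 - e] := by
    refine linearIndependent_triple fun a b c h => ?_
    have h1 : a • n = 0 := by
      have := congrArg (· * n) h
      simpa [add_mul, sub_mul, hen, hnn] using this
    have h2 : c • n = 0 := by
      have := congrArg (n * ·) h
      simpa [mul_add, mul_sub, hne, hnn] using this
    have ha := (smul_eq_zero.1 h1).resolve_right hn
    have hc := (smul_eq_zero.1 h2).resolve_right hn
    refine ⟨ha, ?_, hc⟩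
    rw [ha, hc] at h
    simpa [hn] using h
  refine nonempty_ringEquiv_of_triple hR upperTriangularTwo.finrank_eq_three hli
    upperTriangularTwo.linearIndependent fun L h₁ h₂ h₃ i j => ?_
  fin_cases i <;> fin_cases j <;>
    simp [h₁, h₂, h₃, he, hen, hne, hnn, mul_sub, sub_mul, upperTriangularTwo.of_mul_of,
      ← upperTriangularTwo.zero_eq_of]

theorem nonempty_ringEquiv_cube (hR : finrank F R = 3) {e w : R}
    (hli : LinearIndependent F ![1, e, w]) (he : e * e = e) (hw : w * w = w) (hew : e * w = 0)
    (hwe : w * e = 0) : Nonempty (R ≃+* F × F × F) := by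
  have hli' : LinearIndependent F ![(1 : F × F × F), (1, 0, 0), (0, 1, 0)] := by
    refine linearIndependent_triple fun a b c h => ?_
    simp [Prod.ext_iff] at h
    obtain ⟨h1, h2, h3⟩ := h
    subst h3
    simpa using And.intro h1 h2
  refine nonempty_ringEquiv_of_triple hR (by simp) hli hli' fun L h₁ h₂ h₃ i j => ?_
  fin_cases i <;> fin_cases j <;> simp [h₁, h₂, h₃, he, hw, hew, hwe, Prod.ext_iff]

/-- The case of an algebra that splits as the product of `F e` and `(1 - e) R`. -/
theorem nonempty_ringEquiv_cube_of_quadratic (hR : finrank F R = 3)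
    (hquad : ∀ a : R, ∃ s t : F, a * a = s • a + t • 1) {e w : R}
    (he : e * e = e) (hli : LinearIndependent F ![1, e, w]) (hew : e * w = 0) (hwe : w * e = 0) :
    (∀ l : F, l * l = l) ∧ Nonempty (R ≃+* F × F × F) := by
  have he0 : e ≠ 0 := hli.ne_zero 1
  obtain ⟨β, α, hw⟩ := hquad w
  have hα : α = 0 := by
    have := congrArg (e * ·) hw
    simp only [← mul_assoc, hew, zero_mul, mul_add, mul_smul_comm, smul_zero, zero_add,
      mul_one] at this
    exact (smul_eq_zero.1 this.symm).resolve_right he0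
  simp only [hα, zero_smul, add_zero] at hw
  -- Since `(w + l e)² = β w + l² e`, quadraticity of `w + l e` forces its linear coefficient to be
  -- `β` and `l² = β l`. Taking `l = 1` gives `β = 1`.
  have hl : ∀ l : F, l * l = β * l := by
    intro l
    obtain ⟨s, t, h⟩ := hquad (w + l • e)
    simp only [add_mul, mul_add, smul_mul_assoc, mul_smul_comm, hew, hwe, he, hw, smul_zero,
      add_zero, zero_add] at h
    obtain ⟨h1, h2, h3⟩ := hli.eq_zero_of_triple (a := -t) (b := l * l - s * l) (c := β - s) (by
      rw [← sub_eq_zero] at h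
      rw [← h]
      module)
    linear_combination h2 - l * h3
  have hβ : β = 1 := by simpa using (hl 1).symm
  refine ⟨fun l => by simpa [hβ] using hl l, ?_⟩
  exact nonempty_ringEquiv_cube hR hli he (by simpa [hβ] using hw) hew hwe

/-- A nonzero off-diagonal Peirce component of `v` gives the triangular ring. Otherwise `v` commutes
with `e`, and one of `(1 - e) v`, `e v` supplies the third basis vector, orthogonal to `e` or to `1
- e` respectively. -/
theorem classification_of_idempotent (hR : finrank F R = 3)
    (hquad : ∀ a : R, ∃ s t : F, a * a = s • a + t • 1) {e : R}
    (he : e * e = e) (he1 : ∀ c : F, e ≠ c • 1) :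
    Nonempty (R ≃+* upperTriangularTwo F) ∨
      ((∀ l : F, l * l = l) ∧ Nonempty (R ≃+* F × F × F)) := by
  have : Nontrivial R := nontrivial_of_finrank_pos (R := F) (by omega)
  obtain ⟨v, hv⟩ := exists_ne_combination hR e
  have hf : (1 - e) * (1 - e) = 1 - e := by simp [mul_sub, sub_mul, he]
  have hef : e * (1 - e) = 0 := by simp [mul_sub, he]
  have hfe : (1 - e) * e = 0 := by simp [sub_mul, he]
  by_cases h1 : e * v * (1 - e) = 0
  swap
  · refine Or.inl (nonempty_ringEquiv_upperTriangularTwo hR he h1 ?_ ?_)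
    · rw [← mul_assoc, ← mul_assoc, he]
    · rw [mul_assoc, hfe, mul_zero]
  by_cases h2 : (1 - e) * v * e = 0
  swap
  · refine Or.inl (nonempty_ringEquiv_upperTriangularTwo hR hf h2 ?_ ?_)
    · rw [← mul_assoc, ← mul_assoc, hf]
    · rw [mul_assoc, hef, mul_zero]
  right
  have h1 : e * v = e * v * e := by simpa [mul_sub, sub_eq_zero] using h1
  have h2 : v * e = e * v * e := by simpa [sub_mul, sub_eq_zero] using h2
  have hcomm : v * e = e * v := h2.trans h1.symm
  by_cases hw : ∀ c d : F, v - e * v ≠ c • 1 + d • e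
  · refine nonempty_ringEquiv_cube_of_quadratic hR hquad he
      (linearIndependent_one_of_notMem he1 hw) ?_ ?_
    · rw [mul_sub, ← mul_assoc, he, sub_self]
    · rw [sub_mul, mul_assoc, hcomm, ← mul_assoc, he, sub_self]
  · push Not at hw
    obtain ⟨c, d, hw⟩ := hw
    refine nonempty_ringEquiv_cube_of_quadratic hR hquad hf (w := e * v)
      (linearIndependent_one_of_notMem ?_ ?_) ?_ ?_
    · intro k hk
      refine he1 (1 - k) ?_
      rw [sub_smul, ← hk]
      simp
    · intro c' d' hw'
      refine hv (c + c' + d') (d - d') ?_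
      rw [← sub_add_cancel v (e * v), hw, hw']
      module
    · rw [← mul_assoc, hfe, zero_mul]
    · rw [← hcomm, mul_assoc, hef, mul_zero]

/-- Each element has a shift `b = a - l` with `b² = k b`. If `k ≠ 0`, then `k⁻¹ b` is idempotent; so
when all idempotents are scalar, every non-scalar element has a square-zero shift. -/
theorem classification_of_quadratic (hR : finrank F R = 3)
    (hquad : ∀ a : R, ∃ s t : F, a * a = s • a + t • 1) :
    Nonempty (R ≃+* upperTriangularTwo F) ∨ Nonempty (R ≃+* TwoVarSquareZero F) ∨
      ((∀ l : F, l * l = l) ∧ Nonempty (R ≃+* F × F × F)) := by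
  have : Nontrivial R := nontrivial_of_finrank_pos (R := F) (by omega)
  have key : ∀ a : R, ∃ l k : F, (a - l • 1) * (a - l • 1) = k • (a - l • 1) := fun a => by
    obtain ⟨s, t, h⟩ := hquad a
    exact exists_sub_mul_sub_eq_smul hR h
  by_cases hidem : ∃ e : R, e * e = e ∧ ∀ c : F, e ≠ c • 1
  · obtain ⟨e, he, he1⟩ := hidem
    rcases classification_of_idempotent hR hquad he he1 with h | h
    · exact Or.inl h
    · exact Or.inr (Or.inr h)
  push Not at hidem
  have key' : ∀ a : R, (∀ c : F, a ≠ c • 1) → ∃ l : F, (a - l • 1) * (a - l • 1) = 0 := by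
    intro a ha
    obtain ⟨l, k, h⟩ := key a
    refine ⟨l, ?_⟩
    by_cases hk : k = 0
    · rw [h, hk, zero_smul]
    · obtain ⟨c, hc⟩ := hidem (k⁻¹ • (a - l • 1)) (by
        rw [smul_mul_smul_comm, h, smul_smul, mul_assoc, inv_mul_cancel₀ hk, mul_one])
      refine absurd ?_ (ha (k * c + l))
      have : a - l • 1 = k • c • 1 := by rw [← hc, smul_inv_smul₀ hk]
      rw [← sub_add_cancel a (l • 1), this]
      module
  obtain ⟨a, ha⟩ := exists_ne_smul_one hR
  obtain ⟨v, hv⟩ := exists_ne_combination hR a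
  obtain ⟨l, hl⟩ := key' a ha
  obtain ⟨m, hm⟩ := key' v fun c hc => hv c 0 (by simp [hc])
  refine Or.inr (Or.inl (nonempty_ringEquiv_twoVarSquareZero hR
    (linearIndependent_one_of_notMem ?_ ?_) hl hm))
  · intro c hc
    refine ha (c + l) ?_
    rw [← sub_add_cancel a (l • 1), hc]
    module
  · intro c d hc
    refine hv (c - d * l + m) d ?_
    rw [← sub_add_cancel v (m • 1), hc]
    module

end Quadratic

/-! ### Algebras generated by one element -/

section Cyclic

variable {p : ℕ} [Fact p.Prime] {R : Type*} [Ring R] [Algebra (ZMod p) R]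

/-- If `c` is not a root, the cubic of `b = a - c` has nonzero constant term, so `1` is a polynomial
in `b` without constant term and `b` alone generates `R`. -/
theorem isRoot_of_isCoverable (hR : Module.finrank (ZMod p) R = 3) (hcov : IsCoverable R) {a : R}
    (hli : LinearIndependent (ZMod p) ![1, a, a * a]) {α β γ : ZMod p}
    (ha : a * (a * a) = α • 1 + β • a + γ • (a * a)) (c : ZMod p) :
    c * c * c = α + β * c + γ * (c * c) := by
  by_contra hc
  obtain ⟨S, hS, hb⟩ := hcov.exists_mem (a - c • 1)
  set b := a - c • 1 with hb_def
  -- Taylor expansion of the cubic of `a` at `c`.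
  have hδ : (α + β * c + γ * (c * c) - c * c * c) • (1 : R) =
      b * (b * b) + (3 * c - γ) • (b * b) + (3 * (c * c) - β - 2 * (γ * c)) • b := by
    simp only [hb_def, mul_sub, sub_mul, mul_smul_comm, smul_mul_assoc, mul_one, one_mul, ha]
    module
  have h1 : (1 : R) ∈ S := by
    rw [← inv_smul_smul₀ (sub_ne_zero.2 (Ne.symm hc)) (1 : R), hδ]
    exact ZMod.smul_mem (add_mem (add_mem (mul_mem hb (mul_mem hb hb))
      (ZMod.smul_mem (mul_mem hb hb) _)) (ZMod.smul_mem hb _)) _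
  have ha : a ∈ S := by
    rw [← sub_add_cancel a (c • 1)]
    exact add_mem hb (ZMod.smul_mem h1 _)
  refine hS (eq_top_iff.2 fun r _ => ?_)
  obtain ⟨x, y, z, rfl⟩ := hli.exists_eq_of_triple hR r
  exact add_mem (add_mem (ZMod.smul_mem h1 _) (ZMod.smul_mem ha _))
    (ZMod.smul_mem (mul_mem ha ha) _)

theorem zmod_two_eq_of_add_eq_one :
    ∀ β γ : ZMod 2, 1 * 1 * 1 = 0 + β * 1 + γ * (1 * 1) →
      (β = 0 ∧ γ = 1) ∨ (β = 1 ∧ γ = 0) := by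
  decide

theorem zmod_three_cube_eq_zero : ∀ a b c : ZMod 3,
    a • (1 : ZMod 3 × ZMod 3 × ZMod 3) + b • (0, 1, 2) + c • ((0, 1, 2) * (0, 1, 2)) = 0 →
      a = 0 ∧ b = 0 ∧ c = 0 := by
  decide

theorem zmod_three_cube_pow_three :
    ((0, 1, 2) : ZMod 3 × ZMod 3 × ZMod 3) * ((0, 1, 2) * (0, 1, 2)) =
      (1 : ZMod 3) • (0, 1, 2) + (0 : ZMod 3) • ((0, 1, 2) * (0, 1, 2)) := by
  decide

theorem classification_of_cyclic (hR : Module.finrank (ZMod p) R = 3) (hcov : IsCoverable R)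
    {a : R} (hli : LinearIndependent (ZMod p) ![1, a, a * a]) :
    (p = 3 ∧ Nonempty (R ≃+* ZMod 3 × ZMod 3 × ZMod 3)) ∨
      (p = 2 ∧ Nonempty (R ≃+* ZMod 2 × OneVarSquareZero (ZMod 2))) := by
  have hp : p.Prime := Fact.out
  obtain ⟨α, β, γ, ha⟩ := hli.exists_eq_of_triple hR (a * (a * a))
  have hroot := isRoot_of_isCoverable hR hcov hli ha
  have hα : α = 0 := by simpa using (hroot 0).symm
  subst hα
  have h1 := hroot 1
  have h2 := hroot (-1)
  have h3 := hroot 2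
  simp only [zero_smul, zero_add] at ha
  by_cases hp2 : p = 2
  · subst hp2
    right
    refine ⟨rfl, ?_⟩
    have hS := OneVarSquareZero.finrank_prod_eq_three (F := ZMod 2)
    have hind := OneVarSquareZero.linearIndependent_prod (K := ZMod 2)
    have htt := OneVarSquareZero.t_mul_t (ZMod 2)
    rcases zmod_two_eq_of_add_eq_one β γ h1 with ⟨rfl, rfl⟩ | ⟨rfl, rfl⟩
    -- The cubic is `X² (X - 1)`; in the other case it is `X (X - 1)²`, modelled by `(0, 1 + t)`.
    · refine nonempty_ringEquiv_of_cube hR hS (a' := (1, OneVarSquareZero.t _)) hli ?_ ha ?_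
      · refine linearIndependent_triple fun x y z h => ?_
        obtain ⟨h1, h2, h3⟩ := hind.eq_zero_of_triple (a := x + y + z) (b := x) (c := y) (by
          rw [← h]
          ext <;> simp [htt])
        subst h2 h3
        simpa using h1
      · simp [htt]
    · have ht1 : (1 + OneVarSquareZero.t (ZMod 2)) * (1 + OneVarSquareZero.t (ZMod 2)) = 1 := by
        have : OneVarSquareZero.t (ZMod 2) + OneVarSquareZero.t (ZMod 2) = 0 := by
          rw [← two_smul (ZMod 2), show (2 : ZMod 2) = 0 from rfl, zero_smul]
        simp only [add_mul, mul_add, htt, one_mul, mul_one, add_zero]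
        rw [add_assoc, this, add_zero]
      refine nonempty_ringEquiv_of_cube hR hS (a' := (0, 1 + OneVarSquareZero.t _)) hli ?_ ha ?_
      · refine linearIndependent_triple fun x y z h => ?_
        obtain ⟨h1, h2, h3⟩ := hind.eq_zero_of_triple (a := x) (b := x + y + z) (c := y) (by
          rw [← h]
          ext
          · simp
          · simp [ht1]
            module)
        subst h1 h3
        simpa using h2
      · simp [ht1]
  · have h20 : (2 : ZMod p) ≠ 0 := by
      intro h
      have := (ZMod.natCast_eq_zero_iff 2 p).1 (by exact_mod_cast h)
      exact hp2 ((Nat.prime_dvd_prime_iff_eq hp Nat.prime_two).1 this)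
    -- The roots `1` and `-1` leave only `X³ - X`; the root `2` then gives `6 = 0`.
    have hγ : γ = 0 := by
      have : 2 * γ = 0 := by linear_combination -h1 - h2
      exact (mul_eq_zero.1 this).resolve_left h20
    subst hγ
    have hβ : β = 1 := by linear_combination -h1
    subst hβ
    have h30 : (3 : ZMod p) = 0 := by
      have : (2 : ZMod p) * 3 = 0 := by linear_combination h3
      exact (mul_eq_zero.1 this).resolve_left h20
    have hp3 : p = 3 := by
      have := (ZMod.natCast_eq_zero_iff 3 p).1 (by exact_mod_cast h30)
      exact (Nat.prime_dvd_prime_iff_eq hp Nat.prime_three).1 this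
    subst hp3
    refine Or.inl ⟨rfl, nonempty_ringEquiv_of_cube hR (by simp) (a' := (0, 1, 2)) hli ?_ ha ?_⟩
    · exact linearIndependent_triple zmod_three_cube_eq_zero
    · exact zmod_three_cube_pow_three

end Cyclic

theorem classification_of_charP {p : ℕ} (hp : p.Prime) {R : Type*} [Ring R] [CharP R p]
    (hR : Nat.card R = p ^ 3) (hcov : IsCoverable R) :
    Nonempty (R ≃+* upperTriangularTwo (ZMod p)) ∨
      Nonempty (R ≃+* TwoVarSquareZero (ZMod p)) ∨
      (p = 3 ∧ Nonempty (R ≃+* ZMod 3 × ZMod 3 × ZMod 3)) ∨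
      (p = 2 ∧ Nonempty (R ≃+* ZMod 2 × ZMod 2 × ZMod 2)) ∨
      (p = 2 ∧ Nonempty (R ≃+* ZMod 2 × OneVarSquareZero (ZMod 2))) := by
  have := Fact.mk hp
  let _ : Algebra (ZMod p) R := ZMod.algebra R p
  have hR3 := finrank_zmod_eq_three hR
  by_cases h : ∃ a : R, LinearIndependent (ZMod p) ![1, a, a * a]
  · obtain ⟨a, ha⟩ := h
    have := classification_of_cyclic hR3 hcov ha
    tauto
  · push Not at h
    rcases classification_of_quadratic hR3 fun a =>
      (linearIndependent_or_quadratic a).resolve_left (h a) with h | h | ⟨h2, h⟩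
    · exact Or.inl h
    · exact Or.inr (Or.inl h)
    · have hp2 : p = 2 := by
        have h20 : ((2 : ℕ) : ZMod p) = 0 := by
          have := h2 2
          push_cast
          linear_combination this
        exact (Nat.prime_dvd_prime_iff_eq hp Nat.prime_two).1 ((ZMod.natCast_eq_zero_iff 2 p).1 h20)
      subst hp2
      exact Or.inr (Or.inr (Or.inr (Or.inl ⟨rfl, h⟩)))

/-! ### Rings of characteristic `p²` and `p³` -/

theorem natCard_zmultiples_one (R : Type*) [Ring R] (n : ℕ) [CharP R n] :
    Nat.card (AddSubgroup.zmultiples (1 : R)) = n := by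
  rw [Nat.card_zmultiples]
  exact CharP.eq R (CharP.addOrderOf_one R) inferInstance

/-- A subgroup of prime index is maximal, so adjoining any outside element gives everything. -/
theorem exists_eq_intCast_add {R : Type*} [Ring R] {p : ℕ} (hp : p.Prime)
    (hindex : (AddSubgroup.zmultiples (1 : R)).index = p) {a : R} (ha : ∀ m : ℤ, a ≠ m) (r : R) :
    ∃ m n : ℤ, r = m + n * a := by
  let H := AddSubgroup.zmultiples (1 : R) ⊔ AddSubgroup.zmultiples a
  have hle : AddSubgroup.zmultiples (1 : R) ≤ H := le_sup_left
  have hmul := AddSubgroup.relIndex_mul_index hle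
  rw [hindex] at hmul
  have hH : H = ⊤ := by
    rcases (Nat.dvd_prime hp).1 (Dvd.intro _ hmul) with h | h
    · rw [AddSubgroup.relIndex_eq_one] at h
      have : a ∈ AddSubgroup.zmultiples (1 : R) :=
        h (le_sup_right (a := AddSubgroup.zmultiples (1 : R)) (AddSubgroup.mem_zmultiples a))
      obtain ⟨m, hm⟩ := AddSubgroup.mem_zmultiples_iff.1 this
      exact absurd (by simpa using hm.symm) (ha m)
    · rw [h] at hmul
      exact AddSubgroup.index_eq_one.1 (Nat.eq_of_mul_eq_mul_left hp.pos (by simpa using hmul))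
  have hr : r ∈ H := by rw [hH]; trivial
  obtain ⟨x, hx, y, hy, rfl⟩ := AddSubgroup.mem_sup.1 hr
  obtain ⟨m, rfl⟩ := AddSubgroup.mem_zmultiples_iff.1 hx
  obtain ⟨n, rfl⟩ := AddSubgroup.mem_zmultiples_iff.1 hy
  exact ⟨m, n, by simp⟩

theorem eq_top_of_one_mem_of_mem {R : Type*} [Ring R] {a : R}
    (hspan : ∀ r : R, ∃ m n : ℤ, r = m + n * a) {S : NonUnitalSubring R} (h1 : (1 : R) ∈ S)
    (ha : a ∈ S) : S = ⊤ := by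
  refine eq_top_iff.2 fun r _ => ?_
  obtain ⟨m, n, rfl⟩ := hspan r
  rw [← zsmul_one, ← zsmul_eq_mul]
  exact add_mem (zsmul_mem h1 m) (zsmul_mem ha n)

theorem nonempty_ringEquiv_zmod_two_prod_zmod_four {R : Type*} [Ring R] [CharP R 4]
    (hR : Nat.card R = 2 ^ 3) {e : R} (he : e * e = e) (h2e : (2 : ℤ) * e = 0)
    (hspan : ∀ r : R, ∃ m n : ℤ, r = m + n * e) : Nonempty (R ≃+* ZMod 2 × ZMod 4) := by
  have hf : (1 - e) * (1 - e) = 1 - e := by simp [mul_sub, sub_mul, he]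
  have hef : e * (1 - e) = 0 := by simp [mul_sub, he]
  have hfe : (1 - e) * e = 0 := by simp [sub_mul, he]
  let h : ZMod 2 →+ R := ZMod.lift 2 ⟨zmultiplesHom R e, by simpa using h2e⟩
  let g : ZMod 4 →+* R := ZMod.castHom dvd_rfl R
  have hh : ∀ k : ℤ, h k = k * e := fun k => by simp [h]
  have hg : ∀ k : ℤ, g k = k := fun k => map_intCast g k
  let f : ZMod 2 × ZMod 4 →+* R :=
    { toFun := fun x => h x.1 + g x.2 * (1 - e)
      map_one' := by
        have := hh 1
        simp only [Int.cast_one, one_mul] at this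
        simp [this]
      map_zero' := by simp
      map_add' := by
        rintro ⟨x, y⟩ ⟨x', y'⟩
        simp only [Prod.mk_add_mk, map_add, add_mul]
        abel
      map_mul' := by
        rintro ⟨x, y⟩ ⟨x', y'⟩
        obtain ⟨k, rfl⟩ := ZMod.intCast_surjective x
        obtain ⟨k', rfl⟩ := ZMod.intCast_surjective x'
        obtain ⟨l, rfl⟩ := ZMod.intCast_surjective y
        obtain ⟨l', rfl⟩ := ZMod.intCast_surjective y'
        simp only [Prod.mk_mul_mk, ← Int.cast_mul, hh, hg]
        simp only [← zsmul_eq_mul]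
        simp only [mul_add, add_mul, smul_mul_smul_comm, he, hf, hef, hfe, smul_zero, add_zero,
          zero_add] }
  have hsurj : Function.Surjective f := by
    intro r
    obtain ⟨m, n, rfl⟩ := hspan r
    -- `m + n e = (m + n) e + m (1 - e)`.
    refine ⟨((m + n : ℤ), (m : ℤ)), ?_⟩
    change h _ + g _ * (1 - e) = _
    rw [hh, hg]
    push_cast
    noncomm_ring
  have : Finite R := Nat.finite_of_card_ne_zero (by rw [hR]; norm_num)
  have hbij : Function.Bijective f :=
    hsurj.bijective_of_nat_card_le (by rw [hR]; simp)
  exact ⟨(RingEquiv.ofBijective f hbij).symm⟩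

theorem classification_of_charP_sq {p : ℕ} (hp : p.Prime) {R : Type*} [Ring R] [CharP R (p ^ 2)]
    (hR : Nat.card R = p ^ 3) (hcov : IsCoverable R) :
    p = 2 ∧ Nonempty (R ≃+* ZMod 2 × ZMod 4) := by
  have hcast : ∀ m : ℤ, (p : R) * m = 0 → (p : ℤ) ∣ m := by
    intro m hm
    have h := (CharP.intCast_eq_zero_iff R (p ^ 2) (p * m)).1 (by push_cast; exact hm)
    push_cast at h
    rw [pow_two] at h
    exact Int.dvd_of_mul_dvd_mul_left (by exact_mod_cast hp.ne_zero) h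
  have hpp : (p : R) * p = 0 := by
    have := CharP.cast_eq_zero R (p ^ 2)
    rwa [Nat.cast_pow, pow_two] at this
  have hindex : (AddSubgroup.zmultiples (1 : R)).index = p := by
    have h := AddSubgroup.card_mul_index (AddSubgroup.zmultiples (1 : R))
    rw [natCard_zmultiples_one R (p ^ 2), hR, pow_succ p 2] at h
    exact Nat.eq_of_mul_eq_mul_left (pow_pos hp.pos 2) h
  obtain ⟨a₀, ha₀⟩ : ∃ a : R, ∀ m : ℤ, a ≠ m := by
    by_contra! h
    have : AddSubgroup.zmultiples (1 : R) = ⊤ := eq_top_iff.2 fun r _ => by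
      obtain ⟨m, rfl⟩ := h r
      exact AddSubgroup.mem_zmultiples_iff.2 ⟨m, by simp⟩
    rw [this, AddSubgroup.index_top] at hindex
    exact hp.one_lt.ne hindex
  -- `p a₀` is an integer killed by `p`, hence equal to `p c`; the element `a₀ - c` is then killed
  -- by `p`.
  obtain ⟨a, ha, hpa⟩ : ∃ a : R, (∀ m : ℤ, a ≠ m) ∧ (p : R) * a = 0 := by
    have h := AddSubgroup.nsmul_index_mem (AddSubgroup.zmultiples (1 : R)) a₀
    rw [hindex] at h
    obtain ⟨m, hm⟩ := AddSubgroup.mem_zmultiples_iff.1 h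
    simp only [zsmul_one, nsmul_eq_mul] at hm
    obtain ⟨c, rfl⟩ := hcast m (by rw [hm, ← mul_assoc, hpp, zero_mul])
    refine ⟨a₀ - c, fun k hk => ha₀ (k + c) ?_, ?_⟩
    · push_cast
      rw [← hk, sub_add_cancel]
    · push_cast at hm
      rw [mul_sub, hm, sub_self]
  have hdvd : ∀ n : ℤ, (p : ℤ) ∣ n → (n : R) * a = 0 := by
    rintro _ ⟨k, rfl⟩
    push_cast
    rw [(Nat.cast_commute p (k : R)).eq, mul_assoc, hpa, mul_zero]
  obtain ⟨m, n, haa⟩ := exists_eq_intCast_add hp hindex ha (a * a)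
  obtain ⟨c, rfl⟩ := hcast m (by
    have h := congrArg ((p : R) * ·) haa
    simp only [← mul_assoc, hpa, zero_mul, mul_add] at h
    rw [(Nat.cast_commute p (n : R)).eq, mul_assoc (n : R), hpa, mul_zero, add_zero] at h
    exact h.symm)
  -- If `p ∣ n`, then `a² = p c` and `a³ = 0`, so `b = 1 + a` satisfies `1 = b³ - 3b² + 3b` and
  -- generates `R`.
  by_cases hn : (p : ℤ) ∣ n
  · rw [hdvd n hn, add_zero] at haa
    have h3 : a * (a * a) = 0 := by
      rw [haa, (Int.cast_commute _ a).symm.eq]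
      exact hdvd _ ⟨c, rfl⟩
    obtain ⟨S, hS, hb⟩ := hcov.exists_mem (1 + a)
    have h1 : (1 : R) ∈ S := by
      have : (1 : R) = (1 + a) * ((1 + a) * (1 + a)) - (3 : ℤ) • ((1 + a) * (1 + a)) +
          (3 : ℤ) • (1 + a) := by
        have : (1 + a) * ((1 + a) * (1 + a)) = 1 + 3 • a + 3 • (a * a) + a * (a * a) := by
          noncomm_ring
        rw [this, h3]
        noncomm_ring
      rw [this]
      exact add_mem (sub_mem (mul_mem hb (mul_mem hb hb)) (zsmul_mem (mul_mem hb hb) _))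
        (zsmul_mem hb _)
    have haS : a ∈ S := by simpa using sub_mem hb h1
    exact absurd (eq_top_of_one_mem_of_mem (exists_eq_intCast_add hp hindex ha) h1 haS) hS
  -- With `n'` inverse to `n` modulo `p`, the element `b = n' a` satisfies `b² = p c n'² + b`. As `p
  -- b = 0`, this gives `b³ = b²`, so `b²` is idempotent.
  obtain ⟨e, he, hee, hpe⟩ : ∃ e : R, (∀ m : ℤ, e ≠ m) ∧ e * e = e ∧ (p : R) * e = 0 := by
    have hcop : IsCoprime n (p : ℤ) :=
      ((Nat.prime_iff_prime_int.1 hp).coprime_iff_not_dvd.2 hn).symm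
    obtain ⟨n', k, hk⟩ := hcop
    have hnn' : (n : R) * (n' * a) = a := by
      have := hdvd (k * p) (Dvd.intro_left _ rfl)
      rw [← mul_assoc, ← Int.cast_mul, show n * n' = 1 - k * p by linarith, Int.cast_sub,
        sub_mul, this]
      simp
    set b : R := n' * a with hb
    have hpb : (p : R) * b = 0 := by
      rw [hb, ← mul_assoc, (Nat.cast_commute p (n' : R)).eq, mul_assoc, hpa, mul_zero]
    have hbb : b * b = (p * (c * n' * n') : ℤ) + b := by
      have h1 : b * b = (n' * n' : ℤ) * (a * a) := by
        rw [hb]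
        simp only [← zsmul_eq_mul, smul_mul_smul_comm]
      rw [h1, haa, mul_add, ← mul_assoc (_ : R) (n : R) a, ← Int.cast_mul, ← Int.cast_mul _ n]
      congr 1
      · congr 1
        ring
      · rw [show n' * n' * n = n' - n' * k * p by linear_combination n' * hk, Int.cast_sub,
          sub_mul, hdvd (n' * k * p) (Dvd.intro_left _ rfl), sub_zero]
    have hbbb : b * b * b = b * b := by
      conv_lhs => rw [hbb]
      rw [add_mul]
      push_cast
      rw [(Nat.cast_commute p _).eq, mul_assoc, hpb, mul_zero, zero_add]
    refine ⟨b * b, fun m hm => ?_, by rw [← mul_assoc, hbbb, hbbb], by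
      rw [← mul_assoc, hpb, zero_mul]⟩
    refine ha (n * (m - p * (c * n' * n'))) ?_
    have : b = ((m - p * (c * n' * n') : ℤ) : R) := by
      rw [Int.cast_sub, ← hm, hbb]
      abel
    rw [← hnn', this, ← Int.cast_mul]
  have hspan := exists_eq_intCast_add hp hindex he
  rcases hp.eq_two_or_odd' with rfl | ⟨y, hy⟩
  · have : CharP R 4 := (inferInstance : CharP R (2 ^ 2))
    exact ⟨rfl, nonempty_ringEquiv_zmod_two_prod_zmod_four hR hee (by simpa using hpe) hspan⟩
  · obtain ⟨S, hS, hb⟩ := hcov.exists_mem (1 + e)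
    have h1 : (1 : R) ∈ S := by
      -- As `(1 + e)² = 1 + 3e`, the right side is `1 + (2y + 1) e`, and `2y + 1 = p` kills `e`.
      have : (1 : R) = (1 - y : ℤ) • (1 + e) + (y : ℤ) • ((1 + e) * (1 + e)) := by
        have h2 : (1 + e) * (1 + e) = 1 + 3 • e := by
          simp only [mul_add, add_mul, hee, mul_one, one_mul]
          abel
        have h3 : (2 * y + 1 : ℤ) • e = 0 := by
          rw [← hpe, hy, zsmul_eq_mul]
          push_cast
          rfl
        rw [h2]
        calc (1 : R) = 1 + (2 * y + 1 : ℤ) • e := by rw [h3, add_zero]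
          _ = _ := by module
      rw [this]
      exact add_mem (zsmul_mem hb _) (zsmul_mem (mul_mem hb hb) _)
    have heS : e ∈ S := by simpa using sub_mem hb h1
    exact absurd (eq_top_of_one_mem_of_mem hspan h1 heS) hS

theorem not_isCoverable_of_charP_natCard {R : Type*} [Ring R] [Finite R] [CharP R (Nat.card R)] :
    ¬ IsCoverable R := by
  intro hcov
  obtain ⟨S, hS, h1⟩ := hcov.exists_mem 1
  have htop := AddSubgroup.eq_top_of_card_eq _ (natCard_zmultiples_one R (Nat.card R))
  refine hS (eq_top_iff.2 fun r _ => ?_)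
  obtain ⟨m, rfl⟩ := AddSubgroup.mem_zmultiples_iff.1 (htop ▸ AddSubgroup.mem_top r)
  exact zsmul_mem h1 m

/-! ### Assembly by characteristic -/

theorem mainTheorem5 (p : ℕ) (hp : p.Prime) :
    -- the listed rings are exactly the coverable unital rings of order `p ^ 3`
    (∀ (R : Type*) [Ring R], Nat.card R = p ^ 3 →
      (IsCoverable R ↔
        Nonempty (R ≃+* upperTriangularTwo (ZMod p)) ∨
        Nonempty (R ≃+* TwoVarSquareZero (ZMod p)) ∨
        (p = 3 ∧ Nonempty (R ≃+* ZMod 3 × ZMod 3 × ZMod 3)) ∨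
        (p = 2 ∧ Nonempty (R ≃+* ZMod 2 × ZMod 2 × ZMod 2)) ∨
        (p = 2 ∧ Nonempty (R ≃+* ZMod 2 × OneVarSquareZero (ZMod 2))) ∨
        (p = 2 ∧ Nonempty (R ≃+* ZMod 2 × ZMod 4)))) ∧
    -- orders and covering numbers of the listed rings
    (Nat.card (upperTriangularTwo (ZMod p)) = p ^ 3 ∧
      coveringNumber (upperTriangularTwo (ZMod p)) = p + 1) ∧
    (Nat.card (TwoVarSquareZero (ZMod p)) = p ^ 3 ∧
      coveringNumber (TwoVarSquareZero (ZMod p)) = p + 1) ∧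
    (Nat.card (ZMod 3 × ZMod 3 × ZMod 3) = 3 ^ 3 ∧
      coveringNumber (ZMod 3 × ZMod 3 × ZMod 3) = 6) ∧
    (Nat.card (ZMod 2 × ZMod 2 × ZMod 2) = 2 ^ 3 ∧
      coveringNumber (ZMod 2 × ZMod 2 × ZMod 2) = 3) ∧
    (Nat.card (ZMod 2 × OneVarSquareZero (ZMod 2)) = 2 ^ 3 ∧
      coveringNumber (ZMod 2 × OneVarSquareZero (ZMod 2)) = 3) ∧
    (Nat.card (ZMod 2 × ZMod 4) = 2 ^ 3 ∧
      coveringNumber (ZMod 2 × ZMod 4) = 3) := by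
  have hT := upperTriangularTwo.coveringNumber_eq hp
  have hQ := TwoVarSquareZero.coveringNumber_eq hp
  have hO := OneVarSquareZero.natCard_prod_eq Nat.prime_two
  have hO' := coveringNumber_zmod_two_prod_oneVarSquareZero hO
  refine ⟨fun R _ hR => ⟨fun hcov => ?_, ?_⟩, ⟨upperTriangularTwo.natCard_eq hp, hT⟩,
    ⟨TwoVarSquareZero.natCard_eq hp, hQ⟩, ⟨by simp, coveringNumber_zmod_three_cube⟩,
    ⟨by simp, coveringNumber_zmod_two_cube⟩, ⟨hO, hO'⟩,
    ⟨by simp, coveringNumber_zmod_two_prod_zmod_four⟩⟩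
  · have : Finite R := Nat.finite_of_card_ne_zero (by rw [hR]; exact pow_ne_zero _ hp.ne_zero)
    obtain ⟨n, hn⟩ := CharP.exists R
    -- The characteristic is the order of the additive subgroup generated by `1`.
    have hdvd : n ∣ p ^ 3 := by
      have h := AddSubgroup.card_addSubgroup_dvd_card (AddSubgroup.zmultiples (1 : R))
      rwa [natCard_zmultiples_one R n, hR] at h
    obtain ⟨k, hk, rfl⟩ := (Nat.dvd_prime_pow hp).1 hdvd
    interval_cases k
    · have : CharP R 1 := by simpa using hn
      have := CharP.CharOne.subsingleton (R := R)
      have h1 : Nat.card R = 1 := Nat.card_eq_one_iff_unique.2 ⟨this, ⟨0⟩⟩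
      rw [hR] at h1
      exact absurd (Nat.pow_eq_one.1 h1) (by simp [hp.one_lt.ne'])
    · have : CharP R p := by simpa using hn
      have := classification_of_charP hp hR hcov
      tauto
    · have := classification_of_charP_sq hp hR hcov
      tauto
    · rw [← hR] at hn
      exact absurd hcov not_isCoverable_of_charP_natCard
  · rintro (⟨⟨f⟩⟩ | ⟨⟨f⟩⟩ | ⟨-, ⟨f⟩⟩ | ⟨-, ⟨f⟩⟩ | ⟨-, ⟨f⟩⟩ | ⟨-, ⟨f⟩⟩) <;>
      refine IsCoverable.of_ringEquiv f (isCoverable_of_coveringNumber_ne_top ?_)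
    · rw [hT]
      exact_mod_cast ENat.natCast_ne_top (p + 1)
    · rw [hQ]
      exact_mod_cast ENat.natCast_ne_top (p + 1)
    · rw [coveringNumber_zmod_three_cube]
      exact ENat.natCast_ne_top 6
    · rw [coveringNumber_zmod_two_cube]
      exact ENat.natCast_ne_top 3
    · rw [hO']
      exact ENat.natCast_ne_top 3
    · rw [coveringNumber_zmod_two_prod_zmod_four]
      exact ENat.natCast_ne_top 3
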